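/- Let $\mathcal{H}$ be a complex Hilbert space (of arbitrary dimension), let $A,B$ be compact self-adjoint operators on $\mathcal{H}$, and let $\rho$ be a state, i.e. a positive trace class operator with $\mathrm{tr}[\rho]=1$. For a compact self-adjoint operator $X$ with spectrum $\sigma(X)\subset\mathbb{R}$ and $x\in\sigma(X)$ let $P_X(x)$ be the orthogonal projection onto $\ker(X-x)$, and let $\Pi_A(a)(\rho):=P_A(a)\,\rho\,P_A(a)$ for $a\in\sigma(A)$. Then the series $$\Lambda_A(\rho):=\sum_{a\in\sigma(A)}\Pi_A(a)(\rho)$$ converges unconditionally in trace norm and $\Lambda_A(\rho)$ is again a state; the series $$\langle A\to B\rangle^{\mathrm{op}}_\rho:=\sum_{a\in\sigma(A),\,b\in\sigma(B)}ab\,\mathrm{tr}\bigl[\Pi_A(a)(\rho)\,P_B(b)\bigr]$$ (the operational correlation) converges absolutely; and for every $\alpha\in\mathbb{R}$, with $A\circ_\alpha B:=\alpha AB+(1-\alpha)BA$ and $\langle X\rangle_\rho:=\mathrm{tr}[\rho X]$, $$\langle A\to B\rangle^{\mathrm{op}}_\rho=\langle A\circ_\alpha B\rangle_{\Lambda_A(\rho)}.$$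 -/

import Mathlib

namespace QuantumCorrelation

open Filter Topology
open scoped InnerProductSpace ENNReal

noncomputable section

variable {H : Type*} [NormedAddCommGroup H] [InnerProductSpace ℂ H]

/-- The eigenspace `ker (A - a)`. -/
def eigenspace (A : H →L[ℂ] H) (a : ℝ) : Submodule ℂ H :=
  Module.End.eigenspace (A : H →ₗ[ℂ] H) (a : ℂ)

theorem isClosed_eigenspace (A : H →L[ℂ] H) (a : ℝ) :
    IsClosed (eigenspace A a : Set H) := by
  have h : (eigenspace A a : Set H) = {x | A x = (a : ℂ) • x} := by
    ext x
    exact Module.End.mem_eigenspace_iff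
  rw [h]
  exact isClosed_eq A.continuous (continuous_const_smul _)

variable [CompleteSpace H]

variable (H) in
/-- The index set of a fixed (arbitrarily chosen) orthonormal Hilbert basis of `H`. -/
def basisIndex : Set H :=
  (exists_hilbertBasis ℂ H).choose

variable (H) in
/-- A fixed (arbitrarily chosen) orthonormal Hilbert basis of `H`. -/
def stdBasis : HilbertBasis (basisIndex H) ℂ H :=
  (exists_hilbertBasis ℂ H).choose_spec.choose

/-- The trace norm `‖T‖₁ = tr |T| = ∑ᵢ ⟨eᵢ, |T| eᵢ⟩ ∈ [0, ∞]`, where `|T| = (T† T)^{1/2}`.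
The summands are non-negative and the value does not depend on the orthonormal basis. -/
def traceNorm (T : H →L[ℂ] H) : ℝ≥0∞ :=
  ∑' i, ENNReal.ofReal (RCLike.re ⟪stdBasis H i, CFC.abs T (stdBasis H i)⟫_ℂ)

/-- `T` is of trace class, `T ∈ 𝒯(H)`. -/
def IsTraceClass (T : H →L[ℂ] H) : Prop :=
  traceNorm T < ∞

/-- The trace `tr T = ∑ᵢ ⟨eᵢ, T eᵢ⟩`. For `T` of trace class the series converges absolutely
and its sum does not depend on the orthonormal basis. -/
def trace (T : H →L[ℂ] H) : ℂ :=
  ∑' i, ⟪stdBasis H i, T (stdBasis H i)⟫_ℂ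

/-- States (density operators): positive trace class operators of trace one. -/
def IsState (ρ : H →L[ℂ] H) : Prop :=
  ρ.IsPositive ∧ IsTraceClass ρ ∧ trace ρ = 1

/-- Quantum observables: compact self-adjoint operators. -/
def IsObservable (A : H →L[ℂ] H) : Prop :=
  IsSelfAdjoint A ∧ IsCompactOperator A

instance (A : H →L[ℂ] H) (a : ℝ) : CompleteSpace (eigenspace A a) :=
  (isClosed_eigenspace A a).completeSpace_coe

/-- The spectral projection `P_A(a)` of a compact self-adjoint operator `A` at the point `a`:
the orthogonal projection onto `ker (A - a)`. It is `0` if `a` is not an eigenvalue, which for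
`a` in the spectrum can happen only at `a = 0`. -/
def spectralProj (A : H →L[ℂ] H) (a : ℝ) : H →L[ℂ] H :=
  (eigenspace A a).starProjection

/-- The Lüders operation `Π_A(a) : ρ ↦ P_A(a) ρ P_A(a)`. -/
def luders (A : H →L[ℂ] H) (a : ℝ) (ρ : H →L[ℂ] H) : H →L[ℂ] H :=
  spectralProj A a * ρ * spectralProj A a

/-- The non-selective projective measurement `Λ_A(ρ) = ∑_{a ∈ σ(A)} Π_A(a)(ρ)`.
The sum is taken in the operator norm; for states it converges even in trace norm, to the same
limit because `‖T‖ ≤ ‖T‖₁`. -/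
def nonselective (A ρ : H →L[ℂ] H) : H →L[ℂ] H :=
  ∑' a : spectrum ℝ A, luders A a ρ

/-- The joint probability `P_ρ^{A→B}(a→b) = tr[Π_A(a)(ρ) P_B(b)]` of the sequential projective
measurement of `A` and then `B`. -/
def jointProb (A B ρ : H →L[ℂ] H) (a b : ℝ) : ℂ :=
  trace (luders A a ρ * spectralProj B b)

/-- The operational correlation `⟨A→B⟩^op_ρ = ∑_{a,b} a b P_ρ^{A→B}(a→b)`, summed over
`a ∈ σ(A)` and `b ∈ σ(B)`. -/
def operationalCorrelation (A B ρ : H →L[ℂ] H) : ℂ :=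
  ∑' p : spectrum ℝ A × spectrum ℝ B,
    ((p.1 : ℝ) : ℂ) * ((p.2 : ℝ) : ℂ) * jointProb A B ρ p.1 p.2

/-- `A ∘_α B = α A B + (1 - α) B A`. -/
def algProd (α : ℝ) (A B : H →L[ℂ] H) : H →L[ℂ] H :=
  (α : ℂ) • (A * B) + ((1 - α : ℝ) : ℂ) • (B * A)

/-- The expectation value `⟨X⟩_ρ = tr[ρ X]`. -/
def expectation (ρ X : H →L[ℂ] H) : ℂ :=
  trace (ρ * X)

end

end QuantumCorrelation

namespace QuantumCorrelation

open Filter Topology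
open scoped InnerProductSpace ENNReal

section HilbertSchmidt

variable {H : Type*} [NormedAddCommGroup H] [InnerProductSpace ℂ H]
  {ι κ : Type*} (e : HilbertBasis ι ℂ H)

theorem hasSum_norm_inner_sq (x : H) : HasSum (fun i => ‖⟪e i, x⟫_ℂ‖ ^ 2) (‖x‖ ^ 2) := by
  have h := Complex.hasSum_re (e.hasSum_inner_mul_inner x x)
  rw [inner_self_eq_norm_sq_to_K] at h
  convert h using 1
  · funext i
    rw [← inner_conj_symm x, RCLike.conj_mul]
    norm_cast
  · norm_cast

theorem summable_prod_of_hasSum {f : ι → κ → ℝ} {g : ι → ℝ} (hf : ∀ i k, 0 ≤ f i k)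
    (hfg : ∀ i, HasSum (f i) (g i)) (hg : Summable g) :
    Summable (fun p : ι × κ => f p.1 p.2) := by
  rw [summable_prod_of_nonneg (fun p => hf p.1 p.2)]
  exact ⟨fun i => (hfg i).summable, by simpa [(hfg _).tsum_eq] using hg⟩

theorem summable_norm_inner_sq {S : H →L[ℂ] H} (hS : Summable fun i => ‖S (e i)‖ ^ 2) :
    Summable (fun p : ι × ι => ‖⟪e p.2, S (e p.1)⟫_ℂ‖ ^ 2) :=
  summable_prod_of_hasSum (f := fun i j => ‖⟪e j, S (e i)⟫_ℂ‖ ^ 2) (fun _ _ => by positivity)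
    (fun i => hasSum_norm_inner_sq e (S (e i))) hS

theorem summable_mul_of_sq {f g : ι → ℝ} (hf : Summable fun i => f i ^ 2)
    (hg : Summable fun i => g i ^ 2) : Summable fun i => f i * g i := by
  refine Summable.of_norm_bounded (hf.add hg) fun i => ?_
  rw [Real.norm_eq_abs, abs_le]
  constructor <;> nlinarith [sq_nonneg (f i + g i), sq_nonneg (f i - g i), sq_nonneg (f i),
    sq_nonneg (g i)]

theorem summable_inner_of_sq {u v : ι → H} (hu : Summable fun i => ‖u i‖ ^ 2)
    (hv : Summable fun i => ‖v i‖ ^ 2) : Summable fun i => ⟪u i, v i⟫_ℂ :=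
  Summable.of_norm_bounded (summable_mul_of_sq hu hv) fun _ => norm_inner_le_norm _ _

theorem summable_norm_sq_apply (X : H →L[ℂ] H) {u : ι → H} (hu : Summable fun i => ‖u i‖ ^ 2) :
    Summable fun i => ‖X (u i)‖ ^ 2 := by
  refine Summable.of_nonneg_of_le (fun _ => by positivity) (fun i => ?_) (hu.mul_left (‖X‖ ^ 2))
  rw [← mul_pow]
  exact pow_le_pow_left₀ (norm_nonneg _) (X.le_opNorm _) 2

variable [CompleteSpace H]

theorem hasSum_norm_sq_adjoint {S : H →L[ℂ] H} {t : ℝ} (hS : HasSum (fun i => ‖S (e i)‖ ^ 2) t) :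
    HasSum (fun i => ‖S.adjoint (e i)‖ ^ 2) t := by
  have h := summable_norm_inner_sq e hS.summable
  have h1 := h.hasSum.prod_fiberwise (g := fun i => ‖S (e i)‖ ^ 2)
    fun i => hasSum_norm_inner_sq e (S (e i))
  have h2 := h.prod_symm.hasSum.prod_fiberwise (g := fun j => ‖S.adjoint (e j)‖ ^ 2) fun j => by
    convert hasSum_norm_inner_sq e (S.adjoint (e j)) using 3 with i
    rw [ContinuousLinearMap.adjoint_inner_right, norm_inner_symm]
    rfl
  convert h2 using 1
  rw [← h1.unique hS]
  exact ((Equiv.prodComm ι ι).tsum_eq _).symm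

theorem summable_norm_sq_adjoint {S : κ → H →L[ℂ] H}
    (hS : Summable fun p : κ × ι => ‖S p.1 (e p.2)‖ ^ 2) :
    Summable fun p : κ × ι => ‖(S p.1).adjoint (e p.2)‖ ^ 2 := by
  rw [summable_prod_of_nonneg (fun _ => by positivity)] at hS
  exact summable_prod_of_hasSum (fun _ _ => by positivity)
    (fun k => hasSum_norm_sq_adjoint e (hS.1 k).hasSum) hS.2

/-- Cyclicity of the trace for the product of two Hilbert-Schmidt operators. -/
theorem tsum_inner_eq_tsum_inner_adjoint {S T : H →L[ℂ] H} (hS : Summable fun i => ‖S (e i)‖ ^ 2)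
    (hT : Summable fun i => ‖T (e i)‖ ^ 2) :
    ∑' i, ⟪S (e i), T (e i)⟫_ℂ = ∑' i, ⟪T.adjoint (e i), S.adjoint (e i)⟫_ℂ := by
  have key : Summable (fun p : ι × ι => ⟪S (e p.1), e p.2⟫_ℂ * ⟪e p.2, T (e p.1)⟫_ℂ) := by
    refine Summable.of_norm_bounded
      (summable_mul_of_sq (summable_norm_inner_sq e hS) (summable_norm_inner_sq e hT)) fun p => ?_
    rw [norm_mul, norm_inner_symm]
  have h1 := Summable.tsum_comm (f := fun i j => ⟪S (e i), e j⟫_ℂ * ⟪e j, T (e i)⟫_ℂ) key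
  simp_rw [(e.hasSum_inner_mul_inner _ _).tsum_eq] at h1
  rw [← h1]
  refine tsum_congr fun j => ?_
  rw [← (e.hasSum_inner_mul_inner _ _).tsum_eq]
  refine tsum_congr fun i => ?_
  rw [ContinuousLinearMap.adjoint_inner_left, ContinuousLinearMap.adjoint_inner_right, mul_comm]

theorem norm_sq_le_tsum {S : H →L[ℂ] H} (hS : Summable fun i => ‖S (e i)‖ ^ 2) :
    ‖S‖ ^ 2 ≤ ∑' i, ‖S (e i)‖ ^ 2 := by
  have h0 : 0 ≤ ∑' i, ‖S (e i)‖ ^ 2 := tsum_nonneg fun _ => by positivity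
  rw [← Real.le_sqrt (norm_nonneg _) h0, ← ContinuousLinearMap.adjoint.norm_map S]
  refine ContinuousLinearMap.opNorm_le_bound _ (Real.sqrt_nonneg _) fun x => ?_
  refine (sq_le_sq₀ (by positivity) (by positivity)).1 ?_
  rw [mul_pow, Real.sq_sqrt h0, ← tsum_mul_right]
  refine hasSum_le (fun i => ?_) (hasSum_norm_inner_sq e _) (hS.mul_right _).hasSum
  rw [ContinuousLinearMap.adjoint_inner_right, ← mul_pow]
  exact pow_le_pow_left₀ (norm_nonneg _) (norm_inner_le_norm _ _) 2

end HilbertSchmidt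

section Spectral

variable {H : Type*} [NormedAddCommGroup H] [InnerProductSpace ℂ H] [CompleteSpace H]

theorem adjoint_spectralProj (A : H →L[ℂ] H) (a : ℝ) :
    (spectralProj A a).adjoint = spectralProj A a :=
  (isSelfAdjoint_starProjection (eigenspace A a)).adjoint_eq

theorem spectralProj_mul_self (A : H →L[ℂ] H) (a : ℝ) :
    spectralProj A a * spectralProj A a = spectralProj A a :=
  Submodule.isIdempotentElem_starProjection _

theorem inner_spectralProj_self (A : H →L[ℂ] H) (a : ℝ) (x : H) :
    ⟪x, spectralProj A a x⟫_ℂ = (‖spectralProj A a x‖ ^ 2 : ℝ) := by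
  have h : spectralProj A a x = spectralProj A a (spectralProj A a x) :=
    (DFunLike.congr_fun (spectralProj_mul_self A a) x).symm
  rw [h, ← ContinuousLinearMap.adjoint_inner_left, adjoint_spectralProj, ← h,
    inner_self_eq_norm_sq_to_K]
  norm_cast

theorem mul_spectralProj (A : H →L[ℂ] H) (a : ℝ) :
    A * spectralProj A a = (a : ℂ) • spectralProj A a := by
  ext x
  exact Module.End.mem_eigenspace_iff.1 ((eigenspace A a).starProjection_apply_mem x)

omit [CompleteSpace H] in
theorem eigenspace_eq_bot {A : H →L[ℂ] H} {a : ℝ} (ha : a ∉ spectrum ℝ A) :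
    eigenspace A a = ⊥ := by
  rw [spectrum.notMem_iff] at ha
  obtain ⟨u, hu⟩ := ha
  rw [Submodule.eq_bot_iff]
  intro x hx
  have h0 : (u : H →L[ℂ] H) x = 0 := by
    have := Module.End.mem_eigenspace_iff.1 hx
    rw [hu, _root_.sub_apply, Algebra.algebraMap_eq_smul_one]
    simpa [sub_eq_zero] using this.symm
  have : ((u⁻¹ : (H →L[ℂ] H)ˣ) : H →L[ℂ] H) ((u : H →L[ℂ] H) x) = x :=
    DFunLike.congr_fun u.inv_mul x
  rw [← this, h0, map_zero]

theorem isHilbertSum_eigenspace {A : H →L[ℂ] H} (hA : IsObservable A) :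
    IsHilbertSum ℂ (fun a : spectrum ℝ A => eigenspace A a)
      fun a => (eigenspace A a).subtypeₗᵢ := by
  have hsymm : (A : H →ₗ[ℂ] H).IsSymmetric := hA.1.isSymmetric
  refine IsHilbertSum.mkInternal (F := fun a : spectrum ℝ A => eigenspace A a) ?_ ?_
  · exact hsymm.orthogonalFamily_eigenspaces.comp (γ := spectrum ℝ A) (f := fun a => ((a : ℝ) : ℂ))
      fun a b h => Subtype.ext (Complex.ofReal_injective h)
  · have h := ContinuousLinearMap.orthogonalComplement_iSup_eigenspaces_eq_bot hA.2 hsymm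
    rw [← Submodule.topologicalClosure_eq_top_iff] at h
    rw [← h]
    refine Submodule.topologicalClosure_mono (iSup_le fun μ => ?_)
    by_cases hμ : Module.End.HasEigenvalue (A : H →ₗ[ℂ] H) μ
    · obtain ⟨r, rfl⟩ := Complex.conj_eq_iff_real.1 (hsymm.conj_eigenvalue_eq_self hμ)
      have hr : r ∈ spectrum ℝ A := by
        by_contra hr
        exact hμ (eigenspace_eq_bot hr)
      exact le_iSup (fun a : spectrum ℝ A => eigenspace A a) ⟨r, hr⟩
    · rw [Module.End.HasEigenvalue, Module.End.HasUnifEigenvalue, not_not] at hμ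
      exact hμ.le.trans bot_le

theorem hasSum_spectralProj {A : H →L[ℂ] H} (hA : IsObservable A) (x : H) :
    HasSum (fun a : spectrum ℝ A => spectralProj A a x) x := by
  have hS := isHilbertSum_eigenspace hA
  obtain ⟨w, rfl⟩ := hS.linearIsometryEquiv.symm.surjective x
  have h := hS.hasSum_linearIsometryEquiv_symm w
  convert h with a
  refine ((spectralProj A a).hasSum h).unique ?_
  have ha : spectralProj A a (w a) = w a :=
    Submodule.starProjection_eq_self_iff.2 (w a).2
  have h1 := hasSum_single (f := fun b => spectralProj A a (w b)) a fun b hb => by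
    rw [spectralProj, Submodule.starProjection_apply,
      Submodule.orthogonalProjectionOnto_apply_of_mem_orthogonal, Submodule.coe_zero]
    rw [Submodule.mem_orthogonal]
    exact fun y hy => hS.OrthogonalFamily hb.symm ⟨y, hy⟩ (w b)
  rw [ha] at h1
  exact h1

theorem hasSum_norm_sq_spectralProj {A : H →L[ℂ] H} (hA : IsObservable A) (x : H) :
    HasSum (fun a : spectrum ℝ A => ‖spectralProj A a x‖ ^ 2) (‖x‖ ^ 2) := by
  have h := Complex.hasSum_re ((innerSL ℂ x).hasSum (hasSum_spectralProj hA x))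
  simpa [inner_spectralProj_self, inner_self_eq_norm_sq_to_K, ← Complex.ofReal_pow] using h

theorem hasSum_eigenvalue_mul_norm_sq {A : H →L[ℂ] H} (hA : IsObservable A) (x : H) :
    HasSum (fun a : spectrum ℝ A => ((a : ℝ) : ℂ) * (‖spectralProj A a x‖ ^ 2 : ℝ))
      ⟪x, A x⟫_ℂ := by
  have h := ((innerSL ℂ x) ∘L A).hasSum (hasSum_spectralProj hA x)
  refine (congrArg (HasSum · _) (funext fun a => ?_)).mpr h
  have h1 : A (spectralProj A a x) = ((a : ℝ) : ℂ) • spectralProj A a x :=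
    DFunLike.congr_fun (mul_spectralProj A a) x
  change _ = ⟪x, A (spectralProj A a x)⟫_ℂ
  rw [h1, inner_smul_right, inner_spectralProj_self]

theorem abs_le_norm_of_mem_spectrum [Nontrivial H] {A : H →L[ℂ] H} (a : spectrum ℝ A) :
    |(a : ℝ)| ≤ ‖A‖ :=
  spectrum.norm_le_norm_of_mem a.2

end Spectral

section States

variable {H : Type*} [NormedAddCommGroup H] [InnerProductSpace ℂ H] [CompleteSpace H]

theorem traceNorm_of_isPositive {T : H →L[ℂ] H} (hT : T.IsPositive) :
    traceNorm T = ∑' i, ENNReal.ofReal (RCLike.re ⟪stdBasis H i, T (stdBasis H i)⟫_ℂ) := by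
  rw [traceNorm, CFC.abs_of_nonneg T ((ContinuousLinearMap.nonneg_iff_isPositive T).2 hT)]

/-- A state has a self-adjoint Hilbert-Schmidt square root. -/
theorem IsState.exists_sqrt {ρ : H →L[ℂ] H} (hρ : IsState ρ) :
    ∃ R : H →L[ℂ] H, R.adjoint = R ∧ R * R = ρ ∧
      HasSum (fun i => ‖R (stdBasis H i)‖ ^ 2) 1 := by
  have h0 := (ContinuousLinearMap.nonneg_iff_isPositive ρ).2 hρ.1
  have hsa : (CFC.sqrt ρ).adjoint = CFC.sqrt ρ :=
    (IsSelfAdjoint.of_nonneg (CFC.sqrt_nonneg ρ)).adjoint_eq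
  have hmul := CFC.sqrt_mul_sqrt_self ρ h0
  generalize CFC.sqrt ρ = R at hsa hmul
  have hinner (x : H) : ⟪x, ρ x⟫_ℂ = (‖R x‖ ^ 2 : ℝ) := by
    rw [← hmul]
    change ⟪x, R (R x)⟫_ℂ = _
    rw [← ContinuousLinearMap.adjoint_inner_left, hsa, inner_self_eq_norm_sq_to_K]
    norm_cast
  have htr := hρ.2.1
  rw [IsTraceClass, traceNorm_of_isPositive hρ.1] at htr
  have hs := ENNReal.summable_toReal htr.ne
  simp only [hinner, RCLike.re_eq_complex_re, Complex.ofReal_re,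
    ENNReal.toReal_ofReal (sq_nonneg _)] at hs
  refine ⟨R, hsa, hmul, ?_⟩
  convert hs.hasSum
  have h1 := hρ.2.2
  simp only [trace, hinner] at h1
  rw [← Complex.ofReal_tsum] at h1
  exact_mod_cast h1.symm

theorem inner_luders {A R : H →L[ℂ] H} (hR : R.adjoint = R) (a : ℝ) (x y : H) :
    ⟪x, luders A a (R * R) y⟫_ℂ = ⟪R (spectralProj A a x), R (spectralProj A a y)⟫_ℂ := by
  conv_rhs => rw [← ContinuousLinearMap.adjoint_inner_right, hR,
    ← ContinuousLinearMap.adjoint_inner_right, adjoint_spectralProj]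
  rfl

variable {A B R : H →L[ℂ] H} {ι : Type*} (e : HilbertBasis ι ℂ H)

theorem summable_norm_sq_spectralProj (hA : IsObservable A)
    {u : ι → H} (hu : Summable fun i => ‖u i‖ ^ 2) :
    Summable fun p : spectrum ℝ A × ι => ‖spectralProj A p.1 (u p.2)‖ ^ 2 :=
  (summable_prod_of_hasSum (f := fun i (a : spectrum ℝ A) => ‖spectralProj A a (u i)‖ ^ 2)
    (fun _ _ => by positivity) (fun i => hasSum_norm_sq_spectralProj hA (u i)) hu).prod_symm

theorem summable_norm_sq_sqrt_spectralProj (hA : IsObservable A) (hR : R.adjoint = R)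
    (hS : Summable fun i => ‖R (e i)‖ ^ 2) (X : H →L[ℂ] H) :
    Summable fun p : spectrum ℝ A × ι => ‖R (spectralProj A p.1 (X (e p.2)))‖ ^ 2 := by
  have h0 := summable_norm_sq_spectralProj hA (u := fun i => R (e i)) hS
  have h := summable_norm_sq_adjoint e
    (S := fun a : spectrum ℝ A => X.adjoint * spectralProj A a * R)
    (summable_norm_sq_apply X.adjoint
      (u := fun p : spectrum ℝ A × ι => spectralProj A p.1 (R (e p.2))) h0)
  refine h.congr fun p => ?_
  simp only [← ContinuousLinearMap.star_eq_adjoint, star_mul, star_star]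
  rw [ContinuousLinearMap.star_eq_adjoint, ContinuousLinearMap.star_eq_adjoint,
    adjoint_spectralProj, hR]
  rfl

theorem hasSum_luders (hA : IsObservable A) (hR : R.adjoint = R)
    (hS : Summable fun i => ‖R (e i)‖ ^ 2) :
    HasSum (fun a : spectrum ℝ A => luders A a (R * R)) (nonselective A (R * R)) := by
  refine Summable.hasSum ?_
  have h := summable_norm_sq_sqrt_spectralProj e hA hR hS 1
  refine Summable.of_norm_bounded h.prod fun a => ?_
  refine le_trans (le_of_eq ?_) (norm_sq_le_tsum e (S := R * spectralProj A a) (h.prod_factor a))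
  have h2 : luders A a (R * R) = star (R * spectralProj A a) * (R * spectralProj A a) := by
    rw [star_mul, ContinuousLinearMap.star_eq_adjoint, ContinuousLinearMap.star_eq_adjoint,
      adjoint_spectralProj, hR, luders]
    simp only [mul_assoc]
  rw [h2, CStarRing.norm_star_mul_self, sq]

theorem hasSum_inner_luders (hA : IsObservable A) (hR : R.adjoint = R)
    (hS : Summable fun i => ‖R (e i)‖ ^ 2) (x y : H) :
    HasSum (fun a : spectrum ℝ A => ⟪R (spectralProj A a x), R (spectralProj A a y)⟫_ℂ)
      ⟪x, nonselective A (R * R) y⟫_ℂ := by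
  have h := (innerSL ℂ x ∘L ContinuousLinearMap.apply ℂ H y).hasSum (hasSum_luders e hA hR hS)
  refine (congrArg (HasSum · _) (funext fun a => ?_)).mpr h
  exact (inner_luders hR a x y).symm

/-- `tr[P ρ P X] = ∑ᵢ ⟨P R eᵢ, X P R eᵢ⟩` for `ρ = R R`. -/
theorem tsum_inner_sqrt_spectralProj (hR : R.adjoint = R)
    (a : ℝ) (hK : Summable fun i => ‖R (spectralProj A a (e i))‖ ^ 2) (X : H →L[ℂ] H)
    (hX : Summable fun i => ‖R (spectralProj A a (X (e i)))‖ ^ 2) :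
    ∑' i, ⟪R (spectralProj A a (e i)), R (spectralProj A a (X (e i)))⟫_ℂ =
      ∑' i, ⟪spectralProj A a (R (e i)), X (spectralProj A a (R (e i)))⟫_ℂ := by
  refine (tsum_inner_eq_tsum_inner_adjoint e (S := R * spectralProj A a)
    (T := R * spectralProj A a * X) hK hX).trans (tsum_congr fun i => ?_)
  have h1 : (R * spectralProj A a).adjoint = spectralProj A a * R := by
    rw [← ContinuousLinearMap.star_eq_adjoint, star_mul, ContinuousLinearMap.star_eq_adjoint,
      ContinuousLinearMap.star_eq_adjoint, adjoint_spectralProj, hR]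
  have h2 : (R * spectralProj A a * X).adjoint = X.adjoint * (spectralProj A a * R) := by
    rw [← h1, ← ContinuousLinearMap.star_eq_adjoint, star_mul]
    rfl
  rw [h1, h2]
  exact ContinuousLinearMap.adjoint_inner_left X (spectralProj A a (R (e i)))
    (spectralProj A a (R (e i)))

theorem trace_nonselective_mul (hA : IsObservable A) (hR : R.adjoint = R)
    (hS : Summable fun i => ‖R (stdBasis H i)‖ ^ 2) (X : H →L[ℂ] H) :
    trace (nonselective A (R * R) * X) =
      ∑' a : spectrum ℝ A, ∑' i, ⟪spectralProj A a (R (stdBasis H i)),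
        X (spectralProj A a (R (stdBasis H i)))⟫_ℂ := by
  have h1 := summable_norm_sq_sqrt_spectralProj (stdBasis H) hA hR hS 1
  have h2 := summable_norm_sq_sqrt_spectralProj (stdBasis H) hA hR hS X
  have h := Summable.tsum_comm (f := fun (a : spectrum ℝ A) i =>
    ⟪R (spectralProj A a (stdBasis H i)), R (spectralProj A a (X (stdBasis H i)))⟫_ℂ)
    (summable_inner_of_sq h1 h2)
  simp_rw [(hasSum_inner_luders (stdBasis H) hA hR hS _ _).tsum_eq] at h
  refine h.trans (tsum_congr fun a => ?_)
  exact tsum_inner_sqrt_spectralProj (stdBasis H) hR a (h1.prod_factor a) X (h2.prod_factor a)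

theorem jointProb_eq (hA : IsObservable A) (hR : R.adjoint = R)
    (hS : Summable fun i => ‖R (stdBasis H i)‖ ^ 2) (a : spectrum ℝ A) (b : ℝ) :
    jointProb A B (R * R) a b =
      (∑' i, ‖spectralProj B b (spectralProj A a (R (stdBasis H i)))‖ ^ 2 : ℝ) := by
  have h1 := summable_norm_sq_sqrt_spectralProj (stdBasis H) hA hR hS 1
  have h2 := summable_norm_sq_sqrt_spectralProj (stdBasis H) hA hR hS (spectralProj B b)
  have h := tsum_inner_sqrt_spectralProj (stdBasis H) hR a (h1.prod_factor a) _ (h2.prod_factor a)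
  simp_rw [inner_spectralProj_self, ← inner_luders hR] at h
  rw [Complex.ofReal_tsum]
  exact h

theorem inner_nonselective_sub (hA : IsObservable A) (hR : R.adjoint = R)
    (hS : Summable fun i => ‖R (e i)‖ ^ 2) (s : Finset (spectrum ℝ A)) (x : H) :
    (Summable fun a : spectrum ℝ A => ‖R (spectralProj A a x)‖ ^ 2) ∧
    ⟪x, (nonselective A (R * R) - ∑ a ∈ s, luders A a (R * R)) x⟫_ℂ =
      (∑' a : spectrum ℝ A, ‖R (spectralProj A a x)‖ ^ 2 -
        ∑ a ∈ s, ‖R (spectralProj A a x)‖ ^ 2 : ℝ) := by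
  have hn (y : H) : ⟪y, y⟫_ℂ = (‖y‖ ^ 2 : ℝ) := by
    rw [inner_self_eq_norm_sq_to_K]
    norm_cast
  have h := hasSum_inner_luders e hA hR hS x x
  simp only [hn] at h
  have h1 : Summable fun a : spectrum ℝ A => ‖R (spectralProj A a x)‖ ^ 2 :=
    Complex.summable_ofReal.1 h.summable
  refine ⟨h1, ?_⟩
  have hsum (t : Finset (spectrum ℝ A)) : ⟪x, (∑ a ∈ t, luders A a (R * R)) x⟫_ℂ =
      ∑ a ∈ t, ⟪x, luders A a (R * R) x⟫_ℂ := by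
    rw [_root_.sum_apply, inner_sum]
  rw [_root_.sub_apply, inner_sub_right, hsum, ← h.tsum_eq]
  simp only [inner_luders hR, hn]
  push_cast
  rfl

theorem isPositive_nonselective_sub (hA : IsObservable A) (hR : R.adjoint = R)
    (hS : Summable fun i => ‖R (e i)‖ ^ 2) (s : Finset (spectrum ℝ A)) :
    (nonselective A (R * R) - ∑ a ∈ s, luders A a (R * R)).IsPositive := by
  rw [ContinuousLinearMap.isPositive_iff_complex]
  intro x
  obtain ⟨h1, h2⟩ := inner_nonselective_sub e hA hR hS s x
  rw [← inner_conj_symm, h2, Complex.conj_ofReal]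
  refine ⟨rfl, ?_⟩
  rw [RCLike.re_eq_complex_re, Complex.ofReal_re, sub_nonneg]
  exact h1.sum_le_tsum s fun _ _ => by positivity

theorem traceNorm_nonselective_sub (hA : IsObservable A) (hR : R.adjoint = R)
    (hS : Summable fun i => ‖R (stdBasis H i)‖ ^ 2) (s : Finset (spectrum ℝ A)) :
    traceNorm (nonselective A (R * R) - ∑ a ∈ s, luders A a (R * R)) =
      ENNReal.ofReal (∑' a : spectrum ℝ A, ∑' i, ‖R (spectralProj A a (stdBasis H i))‖ ^ 2 -
        ∑ a ∈ s, ∑' i, ‖R (spectralProj A a (stdBasis H i))‖ ^ 2) := by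
  have h := summable_norm_sq_sqrt_spectralProj (stdBasis H) hA hR hS 1
  simp only [one_apply_eq_self] at h
  rw [traceNorm_of_isPositive (isPositive_nonselective_sub (stdBasis H) hA hR hS s)]
  simp only [(inner_nonselective_sub (stdBasis H) hA hR hS s _).2, RCLike.re_eq_complex_re,
    Complex.ofReal_re]
  have hs : Summable fun i => ∑ a ∈ s, ‖R (spectralProj A a (stdBasis H i))‖ ^ 2 :=
    summable_sum fun a _ => h.prod_factor a
  have ht : Summable fun i => ∑' a : spectrum ℝ A, ‖R (spectralProj A a (stdBasis H i))‖ ^ 2 :=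
    h.prod_symm.prod
  rw [← ENNReal.ofReal_tsum_of_nonneg, ht.tsum_sub hs]
  · congr 2
    · exact (Summable.tsum_comm (f := fun (a : spectrum ℝ A) i =>
        ‖R (spectralProj A a (stdBasis H i))‖ ^ 2) h)
    · exact Summable.tsum_finsetSum fun a _ => h.prod_factor a
  · intro i
    rw [sub_nonneg]
    exact (inner_nonselective_sub (stdBasis H) hA hR hS s _).1.sum_le_tsum s
      fun _ _ => by positivity
  · exact ht.sub hs

theorem tendsto_traceNorm_nonselective_sub (hA : IsObservable A) (hR : R.adjoint = R)
    (hS : Summable fun i => ‖R (stdBasis H i)‖ ^ 2) :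
    Tendsto (fun s : Finset (spectrum ℝ A) =>
      traceNorm (nonselective A (R * R) - ∑ a ∈ s, luders A a (R * R))) atTop (𝓝 0) := by
  have h := summable_norm_sq_sqrt_spectralProj (stdBasis H) hA hR hS 1
  simp only [traceNorm_nonselective_sub hA hR hS]
  have h1 := (tendsto_const_nhds (x := ∑' a : spectrum ℝ A,
    ∑' i, ‖R (spectralProj A a (stdBasis H i))‖ ^ 2)).sub h.prod.hasSum
  have h2 := ENNReal.tendsto_ofReal h1
  simpa using h2

theorem isState_nonselective (hA : IsObservable A) (hR : R.adjoint = R)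
    (hS : HasSum (fun i => ‖R (stdBasis H i)‖ ^ 2) 1) : IsState (nonselective A (R * R)) := by
  have h1 := isPositive_nonselective_sub (stdBasis H) hA hR hS.summable ∅
  have h2 := traceNorm_nonselective_sub hA hR hS.summable ∅
  rw [Finset.sum_empty, sub_zero] at h1 h2
  refine ⟨h1, ?_, ?_⟩
  · rw [IsTraceClass, h2]
    exact ENNReal.ofReal_lt_top
  · have h3 := trace_nonselective_mul hA hR hS.summable 1
    rw [mul_one] at h3
    rw [h3]
    have hn (y : H) : ⟪y, (1 : H →L[ℂ] H) y⟫_ℂ = (‖y‖ ^ 2 : ℝ) := by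
      rw [one_apply_eq_self, inner_self_eq_norm_sq_to_K]
      norm_cast
    simp only [hn, ← Complex.ofReal_tsum]
    have h4 := summable_norm_sq_spectralProj hA (u := fun i => R (stdBasis H i)) hS.summable
    rw [← Summable.tsum_comm (f := fun (a : spectrum ℝ A) i =>
      ‖spectralProj A a (R (stdBasis H i))‖ ^ 2) h4]
    simp only [(hasSum_norm_sq_spectralProj hA _).tsum_eq, hS.tsum_eq, Complex.ofReal_one]

theorem summable_norm_sq_spectralProj_spectralProj (hA : IsObservable A) (hB : IsObservable B)
    {u : ι → H} (hu : Summable fun i => ‖u i‖ ^ 2) :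
    Summable fun p : (spectrum ℝ A × spectrum ℝ B) × ι =>
      ‖spectralProj B p.1.2 (spectralProj A p.1.1 (u p.2))‖ ^ 2 := by
  have h := summable_norm_sq_spectralProj hB (summable_norm_sq_spectralProj hA hu)
  rw [← ((Equiv.prodAssoc _ _ _).symm.trans
    ((Equiv.prodComm _ _).prodCongr (Equiv.refl ι))).summable_iff]
  exact h

theorem summable_jointProb [Nontrivial H] (hA : IsObservable A) (hB : IsObservable B)
    (hR : R.adjoint = R) (hS : Summable fun i => ‖R (stdBasis H i)‖ ^ 2) :
    Summable (fun p : spectrum ℝ A × spectrum ℝ B =>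
      ((p.1 : ℝ) : ℂ) * ((p.2 : ℝ) : ℂ) * jointProb A B (R * R) p.1 p.2) := by
  refine Summable.of_norm_bounded
    ((summable_norm_sq_spectralProj_spectralProj hA hB hS).prod.mul_left (‖A‖ * ‖B‖)) fun p => ?_
  rw [jointProb_eq hA hR hS, norm_mul, norm_mul, Complex.norm_real, Complex.norm_real,
    Complex.norm_real, Real.norm_of_nonneg (tsum_nonneg fun _ => by positivity)]
  have h1 := abs_le_norm_of_mem_spectrum p.1
  have h2 := abs_le_norm_of_mem_spectrum p.2
  refine mul_le_mul_of_nonneg_right ?_ (tsum_nonneg fun _ => by positivity)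
  exact mul_le_mul h1 h2 (abs_nonneg _) (norm_nonneg _)

theorem tsum_mul_jointProb [Nontrivial H] (hA : IsObservable A) (hB : IsObservable B)
    (hR : R.adjoint = R) (hS : Summable fun i => ‖R (stdBasis H i)‖ ^ 2) (a : spectrum ℝ A) :
    ∑' b : spectrum ℝ B, ((b : ℝ) : ℂ) * jointProb A B (R * R) a b =
      ∑' i, ⟪spectralProj A a (R (stdBasis H i)), B (spectralProj A a (R (stdBasis H i)))⟫_ℂ := by
  have h := summable_norm_sq_spectralProj hB
    (summable_norm_sq_apply (spectralProj A a) hS)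
  have h1 : Summable (fun p : spectrum ℝ B × basisIndex H => ((p.1 : ℝ) : ℂ) *
      (‖spectralProj B p.1 (spectralProj A a (R (stdBasis H p.2)))‖ ^ 2 : ℝ)) := by
    refine Summable.of_norm_bounded (h.mul_left ‖B‖) fun p => ?_
    rw [norm_mul, Complex.norm_real, Complex.norm_real, Real.norm_of_nonneg (sq_nonneg _)]
    exact mul_le_mul_of_nonneg_right (abs_le_norm_of_mem_spectrum p.1) (sq_nonneg _)
  simp only [jointProb_eq hA hR hS, Complex.ofReal_tsum, ← tsum_mul_left]
  rw [← Summable.tsum_comm (f := fun (b : spectrum ℝ B) i => ((b : ℝ) : ℂ) *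
      (‖spectralProj B b (spectralProj A a (R (stdBasis H i)))‖ ^ 2 : ℝ)) h1]
  simp only [(hasSum_eigenvalue_mul_norm_sq hB _).tsum_eq]

theorem inner_algProd_spectralProj (hA : IsSelfAdjoint A) (α a : ℝ) (x : H) :
    ⟪spectralProj A a x, algProd α A B (spectralProj A a x)⟫_ℂ =
      a * ⟪spectralProj A a x, B (spectralProj A a x)⟫_ℂ := by
  have h : A (spectralProj A a x) = (a : ℂ) • spectralProj A a x :=
    DFunLike.congr_fun (mul_spectralProj A a) x
  have h1 (y : H) : ⟪spectralProj A a x, A y⟫_ℂ = a * ⟪spectralProj A a x, y⟫_ℂ := by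
    rw [← ContinuousLinearMap.adjoint_inner_left, hA.adjoint_eq, h, inner_smul_left,
      Complex.conj_ofReal]
  have hm (S T : H →L[ℂ] H) (y : H) : (S * T) y = S (T y) := rfl
  simp only [algProd, _root_.add_apply, _root_.smul_apply, hm, inner_add_right, inner_smul_right, h1, h, map_smul]
  push_cast
  ring

end States

end QuantumCorrelation

theorem mainTheorem6 {H : Type*} [NormedAddCommGroup H] [InnerProductSpace ℂ H]
    [CompleteSpace H] (A B ρ : H →L[ℂ] H)
    (hA : QuantumCorrelation.IsObservable A) (hB : QuantumCorrelation.IsObservable B)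
    (hρ : QuantumCorrelation.IsState ρ) :
    -- the series defining the post-measurement state converges in trace norm, to a state
    Filter.Tendsto
      (fun s : Finset (spectrum ℝ A) => QuantumCorrelation.traceNorm
        (QuantumCorrelation.nonselective A ρ - ∑ a ∈ s, QuantumCorrelation.luders A a ρ))
      Filter.atTop (nhds 0) ∧
    QuantumCorrelation.IsState (QuantumCorrelation.nonselective A ρ) ∧
    -- the series defining the operational correlation converges absolutely
    Summable (fun p : spectrum ℝ A × spectrum ℝ B =>
      ((p.1 : ℝ) : ℂ) * ((p.2 : ℝ) : ℂ) * QuantumCorrelation.jointProb A B ρ p.1 p.2) ∧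
    -- the operational correlation is an algebraic correlation in the post-measurement state
    ∀ α : ℝ, QuantumCorrelation.operationalCorrelation A B ρ =
      QuantumCorrelation.expectation (QuantumCorrelation.nonselective A ρ)
        (QuantumCorrelation.algProd α A B) := by
  open QuantumCorrelation in
  obtain ⟨R, hR, rfl, hS⟩ := hρ.exists_sqrt
  have hH : Nontrivial H := by
    by_contra h
    rw [not_nontrivial_iff_subsingleton] at h
    have h1 := hS.tsum_eq
    simp [Subsingleton.elim _ (0 : H)] at h1
  refine ⟨tendsto_traceNorm_nonselective_sub hA hR hS.summable, isState_nonselective hA hR hS,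
    summable_jointProb hA hB hR hS.summable, fun α => ?_⟩
  rw [operationalCorrelation, (summable_jointProb hA hB hR hS.summable).tsum_prod, expectation,
    trace_nonselective_mul hA hR hS.summable]
  refine tsum_congr fun a => ?_
  simp only [mul_assoc, tsum_mul_left, inner_algProd_spectralProj hA.1,
    tsum_mul_jointProb hA hB hR hS.summable]
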